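/- Let $X,Y$ be finite sets, let $f:X\times Y\to\{0,1\}$ be a (total) Boolean function, and let $rank(f)$ be the rank over $\mathbb{R}$ of the $|X|\times|Y|$ matrix $M_f=(f(x,y))_{x\in X,\,y\in Y}$. Consider the following protocols between Alice, who gets $x\in X$, and Bob, who gets $y\in Y$. Initially they share some finite number $k\ge 0$ of EPR-pairs $\frac{1}{\sqrt2}(|00\rangle+|11\rangle)$, Alice holding the first and Bob the second qubit of each pair, and each of them holds a finite number of further qubits, all in state $|0\rangle$. They move in turn, Alice first, for a fixed number $r$ of rounds. In round $i$ the player whose turn it is applies a unitary, depending only on this player's own input, to the qubits that the player currently holds, and then sends a set of $q_i$ of these qubits to the other player; which qubits are sent, and hence $q_i$, does not depend on $(x,y)$. At the end one designated output qubit, which belongs to the last message (if there is one), is measured in the computational basis. The cost of the protocol is the number $\ell=q_1+\dots+q_r$ of qubits sent, and the protocol computes $f$ exactly if for every $(x,y)\in X\times Y$ the outcome is $f(x,y)$ with probability $1$. Let $Q^*(f)$ be the minimum of the costs of all such protocols (with arbitrary finite $k$) that compute $f$ exactly. Then $$Q^*(f)\;\ge\;\frac{\log_2 rank(f)}{2},$$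 where for $f\equiv 0$ the right-hand side is read as $0$. -/

import Mathlib

namespace QComm

/-- The two players. -/
inductive Party where
  | alice
  | bob
  deriving DecidableEq

/-- The qubits of the whole system: Alice starts with her halves of `k` EPR-pairs and `a` further
qubits (left summand), Bob starts with his halves of the `k` pairs and `b` further qubits
(right summand). -/
abbrev Qubit (k a b : ℕ) : Type := (Fin k ⊕ Fin a) ⊕ (Fin k ⊕ Fin b)

/-- Who holds a qubit before the protocol starts. -/
def initialHolder {k a b : ℕ} : Qubit k a b → Party
  | Sum.inl _ => Party.alice
  | Sum.inr _ => Party.bob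

/-- The players move in turn, Alice first: rounds `0, 2, 4, …` are hers, `1, 3, 5, …` are Bob's. -/
def sender (i : ℕ) : Party := if Even i then Party.alice else Party.bob

/-- `holder msg i q` is the player who holds the qubit `q` at the beginning of round `i`, when
`msg j` is the set of qubits that the player of round `j` sends to the other one. -/
def holder {k a b : ℕ} (msg : ℕ → Finset (Qubit k a b)) : ℕ → Qubit k a b → Party
  | 0, q => initialHolder q
  | i + 1, q => if q ∈ msg i then sender (i + 1) else holder msg i q

/-- `u ⊗ I`: the operator `u` on the qubits satisfying `p`, the identity on the other qubits
(as a matrix in the computational basis, which is indexed by bit assignments). -/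
def extendById {Q : Type} [Fintype Q] (p : Q → Prop) [DecidablePred p]
    (u : Matrix ({q // p q} → Bool) ({q // p q} → Bool) ℂ) : Matrix (Q → Bool) (Q → Bool) ℂ :=
  Matrix.of fun s t => if ∀ q, ¬ p q → s q = t q then u (fun q => s q) (fun q => t q) else 0

/-- The initial state: the `k` pairs are each in the state `(|00⟩ + |11⟩)/√2`, all other qubits are
in the state `|0⟩`. -/
noncomputable def initialState (k a b : ℕ) : (Qubit k a b → Bool) → ℂ :=
  fun s =>
    if (∀ j : Fin k, s (Sum.inl (Sum.inl j)) = s (Sum.inr (Sum.inl j))) ∧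
        (∀ j : Fin a, s (Sum.inl (Sum.inr j)) = false) ∧
        (∀ j : Fin b, s (Sum.inr (Sum.inr j)) = false)
    then ((1 / Real.sqrt 2 : ℝ) : ℂ) ^ k else 0

/-- A qubit protocol with shared EPR-pairs, on inputs `x : X` for Alice and `y : Y` for Bob.
In round `i < rounds` the player `sender i` applies a unitary, depending on this player's input
only, to the qubits that this player holds, and then sends the qubits in `msg i` to the other
player. Which qubits are sent in a round does not depend on the inputs. -/
structure Protocol (X Y : Type*) where
  /-- the number of EPR-pairs -/
  epr : ℕ
  /-- the number of other qubits that Alice starts with -/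
  workA : ℕ
  /-- the number of other qubits that Bob starts with -/
  workB : ℕ
  /-- the number of rounds -/
  rounds : ℕ
  /-- the qubits sent in each round -/
  msg : ℕ → Finset (Qubit epr workA workB)
  /-- only qubits that the sender holds can be sent -/
  msg_held : ∀ i < rounds, ∀ q ∈ msg i, holder msg i q = sender i
  /-- Alice's unitaries (used in her rounds only) -/
  unitaryA : ∀ i : ℕ, X →
    Matrix.unitaryGroup ({q : Qubit epr workA workB // holder msg i q = Party.alice} → Bool) ℂ
  /-- Bob's unitaries (used in his rounds only) -/
  unitaryB : ∀ i : ℕ, Y →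
    Matrix.unitaryGroup ({q : Qubit epr workA workB // holder msg i q = Party.bob} → Bool) ℂ
  /-- the output qubit -/
  out : Qubit epr workA workB
  /-- the output qubit is on the channel at the end: it is part of the last message -/
  out_mem : ∀ i, i + 1 = rounds → out ∈ msg i

namespace Protocol

variable {X Y : Type*}

/-- The operator applied to the whole system in round `i` on input `(x, y)`. -/
def roundOperator (P : Protocol X Y) (x : X) (y : Y) (i : ℕ) :
    Matrix (Qubit P.epr P.workA P.workB → Bool) (Qubit P.epr P.workA P.workB → Bool) ℂ :=
  if sender i = Party.alice then
    extendById (fun q => holder P.msg i q = Party.alice) (P.unitaryA i x).1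
  else
    extendById (fun q => holder P.msg i q = Party.bob) (P.unitaryB i y).1

/-- The state of the whole system on input `(x, y)` after `i` rounds. -/
noncomputable def state (P : Protocol X Y) (x : X) (y : Y) :
    ℕ → (Qubit P.epr P.workA P.workB → Bool) → ℂ
  | 0 => initialState P.epr P.workA P.workB
  | i + 1 => (P.roundOperator x y i).mulVec (P.state x y i)

/-- The probability that measuring the output qubit of the final state yields `v`. -/
noncomputable def outputProb (P : Protocol X Y) (x : X) (y : Y) (v : Bool) : ℝ :=
  ∑ s : Qubit P.epr P.workA P.workB → Bool,
    if s P.out = v then ‖P.state x y P.rounds s‖ ^ 2 else 0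

/-- The protocol computes `f` exactly: the output is correct with certainty on every input. -/
def ComputesExactly (P : Protocol X Y) (f : X → Y → Bool) : Prop :=
  ∀ x y, P.outputProb x y (f x y) = 1

/-- The number of qubits communicated. -/
def cost (P : Protocol X Y) : ℕ := ∑ i ∈ Finset.range P.rounds, (P.msg i).card

end Protocol

/-- `Q*(f)`: the least cost of a protocol with shared EPR-pairs (any finite number of them) that
computes `f` exactly. -/
noncomputable def Qstar {X Y : Type*} (f : X → Y → Bool) : ℕ∞ :=
  ⨅ (P : Protocol X Y) (_ : P.ComputesExactly f), (P.cost : ℕ∞)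

/-- The communication matrix `M_f`, as a real matrix. -/
def commMatrix {X Y : Type*} (f : X → Y → Bool) : Matrix X Y ℝ :=
  Matrix.of fun x y => if f x y then 1 else 0

end QComm

/-! In the Heisenberg picture the final measurement projection is pulled back through the rounds to
an operator `F x y` on the initial system. The output qubit gives a single product term; undoing a
local unitary keeps the number of terms, and undoing the transfer of a qubit multiplies it by at
most `4`, the number of matrix units of one qubit (`Decomposes.transfer`). So `F x y` is a sum of `4
^ cost` products of an Alice operator depending on `x` and a Bob operator depending on `y`.
Exactness makes the initial state `ψ` an eigenvector of `F x y` with eigenvalue `f x y`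
(`exists_decomposes`).

Since `ψ` is entangled, reading off matrix entries only bounds the rank by the number of terms times
the dimension `D`. But `ψ` is returned unchanged up to a scalar, so it can be reused: `m`-fold
products on the same space give `rank ^ m ≤ (4 ^ cost) ^ m * D` with `D` fixed, and letting `m` grow
removes `D` (`FixesDiagonally.card_le_card`). -/

namespace QComm

open Matrix

/-! ### Operators acting on a subset of the qubits. -/

section Local

variable {Q : Type} [Fintype Q]

theorem extendById_eq_submatrix_kronecker (p : Q → Prop) [DecidablePred p]
    (u : Matrix ({q // p q} → Bool) ({q // p q} → Bool) ℂ) :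
    extendById p u =
      (kroneckerMap (· * ·) u (1 : Matrix ({q // ¬ p q} → Bool) ({q // ¬ p q} → Bool) ℂ)).submatrix
        (Equiv.piEquivPiSubtypeProd p fun _ => Bool)
        (Equiv.piEquivPiSubtypeProd p fun _ => Bool) := by
  ext s t
  simp [extendById, Matrix.one_apply, funext_iff, Equiv.piEquivPiSubtypeProd]

theorem extendById_one [DecidableEq Q] (p : Q → Prop) [DecidablePred p] :
    extendById p (1 : Matrix ({q // p q} → Bool) ({q // p q} → Bool) ℂ) = 1 := by
  rw [extendById_eq_submatrix_kronecker]
  simp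

theorem extendById_mul [DecidableEq Q] (p : Q → Prop) [DecidablePred p]
    (u v : Matrix ({q // p q} → Bool) ({q // p q} → Bool) ℂ) :
    extendById p (u * v) = extendById p u * extendById p v := by
  simp only [extendById_eq_submatrix_kronecker]
  rw [Matrix.submatrix_mul_equiv, ← Matrix.mul_kronecker_mul, one_mul]

theorem extendById_conjTranspose (p : Q → Prop) [DecidablePred p]
    (u : Matrix ({q // p q} → Bool) ({q // p q} → Bool) ℂ) :
    extendById p uᴴ = (extendById p u)ᴴ := by
  ext s t
  simp only [extendById, Matrix.of_apply, Matrix.conjTranspose_apply, apply_ite star, star_zero]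
  simp only [eq_comm]

variable [DecidableEq Q]

/-- Extension by the identity, as a homomorphism of algebras. -/
def extendHom (p : Q → Prop) [DecidablePred p] :
    Matrix ({q // p q} → Bool) ({q // p q} → Bool) ℂ →ₐ[ℂ] Matrix (Q → Bool) (Q → Bool) ℂ :=
  AlgHom.ofLinearMap
    { toFun := extendById p
      map_add' := fun u v => by
        ext s t
        simp only [extendById, Matrix.of_apply, Matrix.add_apply]
        split_ifs <;> simp
      map_smul' := fun c u => by
        ext s t
        simp only [extendById, Matrix.of_apply, Matrix.smul_apply, RingHom.id_apply]
        split_ifs <;> simp }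
    (extendById_one p) (extendById_mul p)

/-- The algebra of the operators that act on the qubits satisfying `p` only. -/
def localAlgebra (p : Q → Prop) [DecidablePred p] :
    Subalgebra ℂ (Matrix (Q → Bool) (Q → Bool) ℂ) :=
  (extendHom p).range

theorem extendById_mem_localAlgebra (p : Q → Prop) [DecidablePred p]
    (u : Matrix ({q // p q} → Bool) ({q // p q} → Bool) ℂ) : extendById p u ∈ localAlgebra p :=
  ⟨u, rfl⟩

theorem exists_eq_extendById {p : Q → Prop} [DecidablePred p]
    {A : Matrix (Q → Bool) (Q → Bool) ℂ} (hA : A ∈ localAlgebra p) :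
    ∃ u, A = extendById p u := by
  obtain ⟨u, rfl⟩ := hA
  exact ⟨u, rfl⟩

/-- The formula is symmetric in the two factors, which yields commutation; it also exhibits the
product as an operator on the union of the two sets. -/
theorem extendById_mul_extendById_apply {p p' : Q → Prop} [DecidablePred p] [DecidablePred p']
    (h : ∀ q, p q → ¬ p' q)
    (u : Matrix ({q // p q} → Bool) ({q // p q} → Bool) ℂ)
    (v : Matrix ({q // p' q} → Bool) ({q // p' q} → Bool) ℂ) (s t : Q → Bool) :
    (extendById p u * extendById p' v) s t =
      if ∀ q, ¬ p q → ¬ p' q → s q = t q then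
        u (fun q => s q) (fun q => t q) * v (fun q => s q) (fun q => t q) else 0 := by
  classical
  -- The only contributing intermediate assignment: the left factor changes bits only on `p`, the
  -- right one only on `p'`.
  rw [Matrix.mul_apply, Finset.sum_eq_single (fun q => if p q then t q else s q)]
  · have h1 : (fun q : {q // p q} => if p q then t q else s q) = fun q : {q // p q} => t q := by
      funext q; simp [q.2]
    have h2 : (fun q : {q // p' q} => if p q then t q else s q) = fun q : {q // p' q} => s q := by
      funext q
      have : ¬ p q := fun hq => h q hq q.2
      simp [this]
    have h3 : (∀ q, ¬ p q → s q = if p q then t q else s q) := fun q hq => by simp [hq]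
    have h4 : (∀ q, ¬ p' q → (if p q then t q else s q) = t q) ↔
        ∀ q, ¬ p q → ¬ p' q → s q = t q := by
      refine forall_congr' fun q => ?_
      by_cases hq : p q <;> simp [hq]
    simp only [extendById, Matrix.of_apply, h1, h2, if_pos h3, h4]
    split_ifs <;> simp
  · intro w _ hw
    by_contra hne
    apply hw
    have hu := left_ne_zero_of_mul hne
    have hv := right_ne_zero_of_mul hne
    simp only [extendById, Matrix.of_apply, ne_eq, ite_eq_right_iff, Classical.not_imp] at hu hv
    funext q
    by_cases hq : p q
    · simp [hq, hv.1 q (h q hq)]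
    · simp [hq, hu.1 q hq]
  · simp

theorem commute_of_mem_localAlgebra {p p' : Q → Prop} [DecidablePred p] [DecidablePred p']
    (h : ∀ q, p q → ¬ p' q) {A B : Matrix (Q → Bool) (Q → Bool) ℂ}
    (hA : A ∈ localAlgebra p) (hB : B ∈ localAlgebra p') : A * B = B * A := by
  obtain ⟨u, rfl⟩ := exists_eq_extendById hA
  obtain ⟨v, rfl⟩ := exists_eq_extendById hB
  ext s t
  rw [extendById_mul_extendById_apply h,
    extendById_mul_extendById_apply fun q hq' hq => h q hq hq', mul_comm]
  congr 1
  exact propext ⟨fun H q a b => H q b a, fun H q a b => H q b a⟩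

theorem mul_mem_localAlgebra_of_or {p p' r : Q → Prop} [DecidablePred p] [DecidablePred p']
    [DecidablePred r] (h : ∀ q, p q → ¬ p' q) (hr : ∀ q, r q ↔ p q ∨ p' q)
    {A B : Matrix (Q → Bool) (Q → Bool) ℂ} (hA : A ∈ localAlgebra p) (hB : B ∈ localAlgebra p') :
    A * B ∈ localAlgebra r := by
  obtain ⟨u, rfl⟩ := exists_eq_extendById hA
  obtain ⟨v, rfl⟩ := exists_eq_extendById hB
  refine ⟨Matrix.of fun s t =>
    u (fun q => s ⟨q, (hr q).2 (.inl q.2)⟩) (fun q => t ⟨q, (hr q).2 (.inl q.2)⟩) *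
      v (fun q => s ⟨q, (hr q).2 (.inr q.2)⟩) (fun q => t ⟨q, (hr q).2 (.inr q.2)⟩), ?_⟩
  ext s t
  rw [extendById_mul_extendById_apply h]
  change extendById r _ s t = _
  simp [extendById, hr, not_or]

/-- An operator on two disjoint sets of qubits is a sum of products of matrix units on the first
set and operators on the second one. -/
theorem exists_sum_single_mul {p p' r : Q → Prop} [DecidablePred p] [DecidablePred p']
    [DecidablePred r] (h : ∀ q, p q → ¬ p' q) (hr : ∀ q, r q ↔ p q ∨ p' q)
    {A : Matrix (Q → Bool) (Q → Bool) ℂ} (hA : A ∈ localAlgebra r) :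
    ∃ B : ({q // p q} → Bool) × ({q // p q} → Bool) → Matrix (Q → Bool) (Q → Bool) ℂ,
      (∀ i, B i ∈ localAlgebra p') ∧
        A = ∑ i, extendById p (Matrix.single i.1 i.2 1) * B i := by
  obtain ⟨u, rfl⟩ := exists_eq_extendById hA
  let glue (a : {q // p q} → Bool) (c : {q // p' q} → Bool) (q : {q // r q}) : Bool :=
    if hp : p q then a ⟨q, hp⟩ else c ⟨q, ((hr q).1 q.2).resolve_left hp⟩
  refine ⟨fun i => extendById p' (Matrix.of fun c d => u (glue i.1 c) (glue i.2 d)),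
    fun i => extendById_mem_localAlgebra _ _, ?_⟩
  ext s t
  have hg (s : Q → Bool) :
      glue (fun q => s q) (fun q => s q) = fun q : {q // r q} => s q := by
    funext q
    simp [glue]
  rw [Matrix.sum_apply]
  refine Eq.symm ((Finset.sum_eq_single
    (fun q : {q // p q} => s q, fun q : {q // p q} => t q) ?_ ?_).trans ?_)
  · rintro ⟨a, b⟩ _ hab
    rw [extendById_mul_extendById_apply h, Matrix.single_apply_of_ne]
    · simp
    · rintro ⟨rfl, rfl⟩
      exact hab rfl
  · simp
  · rw [extendById_mul_extendById_apply h]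
    simp [extendById, hr, not_or, hg]

end Local

/-! ### From product terms to rank, by a power trick on a fixed space. -/

section TensorPower

variable {n : Type*} [Fintype n] [DecidableEq n]

/-- A family of operators `∑ j, A j a * B j b`, with `A j a ∈ S` and `B j b ∈ T`, that maps `ψ` to
`ψ` for `a = b` and to `0` otherwise. -/
def FixesDiagonally (S T : Subalgebra ℂ (Matrix n n ℂ)) (ψ : n → ℂ) (ι J : Type)
    [DecidableEq ι] [Fintype J] : Prop :=
  ∃ A B : J → ι → Matrix n n ℂ, (∀ j a, A j a ∈ S) ∧ (∀ j b, B j b ∈ T) ∧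
    ∀ a b, (∑ j, A j a * B j b) *ᵥ ψ = if a = b then ψ else 0

/-- Both families act on the same `ψ`: the second either kills it or hands it back intact to the
first. Commutation of `S` and `T` regroups the product into Alice and Bob parts. -/
theorem FixesDiagonally.prod {S T : Subalgebra ℂ (Matrix n n ℂ)} {ψ : n → ℂ}
    (hST : ∀ A ∈ S, ∀ B ∈ T, A * B = B * A) {ι J ι' J' : Type}
    [DecidableEq ι] [Fintype J] [DecidableEq ι'] [Fintype J']
    (h : FixesDiagonally S T ψ ι J) (h' : FixesDiagonally S T ψ ι' J') :
    FixesDiagonally S T ψ (ι × ι') (J × J') := by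
  obtain ⟨A, B, hA, hB, hAB⟩ := h
  obtain ⟨A', B', hA', hB', hAB'⟩ := h'
  refine ⟨fun j a => A j.1 a.1 * A' j.2 a.2, fun j b => B j.1 b.1 * B' j.2 b.2,
    fun j a => S.mul_mem (hA _ _) (hA' _ _), fun j b => T.mul_mem (hB _ _) (hB' _ _), ?_⟩
  rintro ⟨a, a'⟩ ⟨b, b'⟩
  have key : ∑ j : J × J', A j.1 a * A' j.2 a' * (B j.1 b * B' j.2 b') =
      (∑ j, A j a * B j b) * ∑ j, A' j a' * B' j b' := by
    rw [Fintype.sum_prod_type, Finset.sum_mul_sum]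
    refine Finset.sum_congr rfl fun j _ => Finset.sum_congr rfl fun j' _ => ?_
    rw [mul_assoc, ← mul_assoc (A' j' a'), hST _ (hA' j' a') _ (hB j b)]
    simp only [mul_assoc]
  rw [key, ← Matrix.mulVec_mulVec, hAB']
  by_cases h2 : a' = b'
  · simp [h2, hAB]
  · simp [h2]

/-- Looking at one coordinate `k` where `ψ` is nonzero factors the identity matrix on `ι` through `J
× n`. -/
theorem FixesDiagonally.card_le {S T : Subalgebra ℂ (Matrix n n ℂ)} {ψ : n → ℂ} (hψ : ψ ≠ 0)
    {ι J : Type} [Fintype ι] [DecidableEq ι] [Fintype J] (h : FixesDiagonally S T ψ ι J) :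
    Fintype.card ι ≤ Fintype.card J * Fintype.card n := by
  obtain ⟨A, B, -, -, hAB⟩ := h
  obtain ⟨k, hk⟩ := Function.ne_iff.1 hψ
  let C : Matrix ι (J × n) ℂ := Matrix.of fun a i => (ψ k)⁻¹ * A i.1 a k i.2
  let D : Matrix (J × n) ι ℂ := Matrix.of fun i b => (B i.1 b *ᵥ ψ) i.2
  have hCD : C * D = 1 := by
    ext a b
    have h1 := congrFun (hAB a b) k
    simp only [Matrix.sum_mulVec, Finset.sum_apply, ← Matrix.mulVec_mulVec] at h1
    have h2 : (C * D) a b = (ψ k)⁻¹ * ∑ j, (A j a *ᵥ (B j b *ᵥ ψ)) k := by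
      simp only [Matrix.mul_apply, Fintype.sum_prod_type, C, D, Matrix.of_apply, Finset.mul_sum,
        Matrix.mulVec, dotProduct, mul_assoc]
    rw [h2, h1, Matrix.one_apply]
    split_ifs
    · exact inv_mul_cancel₀ hk
    · simp
  have h3 : (1 : Matrix ι ι ℂ).rank ≤ Fintype.card (J × n) :=
    hCD ▸ (Matrix.rank_mul_le_left C D).trans (Matrix.rank_le_card_width C)
  simpa [Fintype.card_prod] using h3

theorem FixesDiagonally.exists_pow {S T : Subalgebra ℂ (Matrix n n ℂ)} {ψ : n → ℂ}
    (hST : ∀ A ∈ S, ∀ B ∈ T, A * B = B * A) {ι J : Type}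
    [Fintype ι] [DecidableEq ι] [Fintype J] (h : FixesDiagonally S T ψ ι J) (m : ℕ) :
    ∃ (ι' J' : Type) (_ : Fintype ι') (_ : DecidableEq ι') (_ : Fintype J'),
      Fintype.card ι' = Fintype.card ι ^ m ∧ Fintype.card J' = Fintype.card J ^ m ∧
        FixesDiagonally S T ψ ι' J' := by
  induction m with
  | zero =>
    refine ⟨Unit, Unit, inferInstance, inferInstance, inferInstance, by simp, by simp,
      fun _ _ => 1, fun _ _ => 1, fun _ _ => S.one_mem, fun _ _ => T.one_mem, fun _ _ => ?_⟩
    simp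
  | succ m ih =>
    obtain ⟨ι', J', _, _, _, hι, hJ, h'⟩ := ih
    exact ⟨ι' × ι, J' × J, inferInstance, inferInstance, inferInstance,
      by rw [Fintype.card_prod, hι, pow_succ], by rw [Fintype.card_prod, hJ, pow_succ],
      h'.prod hST h⟩

theorem le_of_forall_pow_le_pow_mul {r N D : ℕ} (h : ∀ m, r ^ m ≤ N ^ m * D) :
    r ≤ N := by
  by_contra! hlt
  rcases Nat.eq_zero_or_pos N with rfl | hN
  · have := h 1
    simp at this
    omega
  have hN' : (0 : ℝ) < N := by exact_mod_cast hN
  have hr : (1 : ℝ) < r / N := by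
    rw [one_lt_div hN']
    exact_mod_cast hlt
  obtain ⟨m, hm⟩ := pow_unbounded_of_one_lt (D : ℝ) hr
  rw [div_pow, lt_div_iff₀ (pow_pos hN' m)] at hm
  have h1 : (r : ℝ) ^ m ≤ N ^ m * D := by exact_mod_cast h m
  linarith [mul_comm (D : ℝ) (N ^ m)]

theorem FixesDiagonally.card_le_card {S T : Subalgebra ℂ (Matrix n n ℂ)} {ψ : n → ℂ}
    (hψ : ψ ≠ 0) (hST : ∀ A ∈ S, ∀ B ∈ T, A * B = B * A) {ι J : Type}
    [Fintype ι] [DecidableEq ι] [Fintype J] (h : FixesDiagonally S T ψ ι J) :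
    Fintype.card ι ≤ Fintype.card J := by
  refine le_of_forall_pow_le_pow_mul (D := Fintype.card n) fun m => ?_
  obtain ⟨ι', J', _, _, _, hι, hJ, h'⟩ := h.exists_pow hST m
  rw [← hι, ← hJ]
  exact h'.card_le hψ

/-- The columns of `R` are preimages of a basis of the range; `P` reads off coordinates after a left
inverse of the inclusion of the range. -/
theorem exists_mul_mul_eq_one {K X Y : Type*} [Field K] [Fintype X] [Fintype Y]
    (M : Matrix X Y K) :
    ∃ (P : Matrix (Fin M.rank) X K) (R : Matrix Y (Fin M.rank) K), P * M * R = 1 := by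
  classical
  let b : Module.Basis (Fin M.rank) K (LinearMap.range M.mulVecLin) := Module.finBasis K _
  choose w hw using fun i => LinearMap.mem_range.1 (b i).2
  obtain ⟨g, hg⟩ := LinearMap.exists_leftInverse_of_injective
    (LinearMap.range M.mulVecLin).subtype (Submodule.ker_subtype _)
  refine ⟨LinearMap.toMatrix' (b.equivFun.toLinearMap ∘ₗ g), Matrix.of fun y i => w i y, ?_⟩
  ext i j
  have h1 : g (M *ᵥ w j) = b j := by
    rw [← Matrix.mulVecLin_apply, hw]
    exact LinearMap.congr_fun hg (b j)
  have h2 : (LinearMap.toMatrix' (b.equivFun.toLinearMap ∘ₗ g) *ᵥ (M *ᵥ w j)) i =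
      (1 : Matrix (Fin M.rank) (Fin M.rank) K) i j := by
    rw [← Matrix.toLin'_apply, Matrix.toLin'_toMatrix', LinearMap.comp_apply, h1]
    simp [Matrix.one_apply, eq_comm]
  rw [← h2, Matrix.mul_assoc]
  rw [Matrix.mulVec_mulVec, ← Matrix.mul_assoc]
  rfl

/-- The rank of a matrix of eigenvalues is at most the number of terms of the operators. -/
theorem rank_le_card_of_mulVec_eq_smul {S T : Subalgebra ℂ (Matrix n n ℂ)} {ψ : n → ℂ}
    (hψ : ψ ≠ 0) (hST : ∀ A ∈ S, ∀ B ∈ T, A * B = B * A) {X Y : Type*} [Fintype X] [Fintype Y]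
    {J : Type} [Fintype J] {A : J → X → Matrix n n ℂ} {B : J → Y → Matrix n n ℂ}
    (hA : ∀ j x, A j x ∈ S) (hB : ∀ j y, B j y ∈ T) (M : Matrix X Y ℝ)
    (hM : ∀ x y, (∑ j, A j x * B j y) *ᵥ ψ = (M x y : ℂ) • ψ) :
    M.rank ≤ Fintype.card J := by
  obtain ⟨P, R, hPR⟩ := exists_mul_mul_eq_one M
  have h : FixesDiagonally S T ψ (Fin M.rank) J := by
    -- Linear combinations over `x` and over `y` turn the eigenvalue matrix `M` into `P * M * R = 1`
    -- without adding terms.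
    refine ⟨fun j a => ∑ x, (P a x : ℂ) • A j x, fun j b => ∑ y, (R y b : ℂ) • B j y,
      fun j a => S.sum_mem fun x _ => S.smul_mem (hA j x) _,
      fun j b => T.sum_mem fun y _ => T.smul_mem (hB j y) _, fun a b => ?_⟩
    have h1 : ∑ j, (∑ x, (P a x : ℂ) • A j x) * ∑ y, (R y b : ℂ) • B j y =
        ∑ x, ∑ y, ((P a x : ℂ) * R y b) • ∑ j, A j x * B j y := by
      simp only [Finset.sum_mul_sum, Finset.smul_sum, smul_mul_smul_comm]
      rw [Finset.sum_comm]
      refine Finset.sum_congr rfl fun x _ => ?_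
      rw [Finset.sum_comm]
    have h2 : ∑ x, ∑ y, (P a x : ℂ) * R y b * M x y = if a = b then 1 else 0 := by
      have h3 := congrFun (congrFun hPR a) b
      rw [Matrix.mul_assoc] at h3
      simp only [Matrix.mul_apply, Matrix.one_apply, Finset.mul_sum] at h3
      have h4 := congrArg (Complex.ofReal) h3
      simp only [Complex.ofReal_sum, Complex.ofReal_mul, apply_ite Complex.ofReal,
        Complex.ofReal_one, Complex.ofReal_zero] at h4
      rw [← h4]
      refine Finset.sum_congr rfl fun x _ => Finset.sum_congr rfl fun y _ => by ring
    have h3 : (∑ x, ∑ y, ((P a x : ℂ) * R y b) • ∑ j, A j x * B j y) *ᵥ ψ =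
        ∑ x, ∑ y, ((P a x : ℂ) * R y b) • ((∑ j, A j x * B j y) *ᵥ ψ) := by
      rw [Matrix.sum_mulVec]
      refine Finset.sum_congr rfl fun x _ => ?_
      rw [Matrix.sum_mulVec]
      exact Finset.sum_congr rfl fun y _ => Matrix.smul_mulVec _ _ _
    rw [h1, h3]
    simp only [hM, smul_smul, ← Finset.sum_smul, h2]
    split_ifs <;> simp
  simpa using h.card_le_card hψ hST

end TensorPower

/-! ### Counting product terms under local operations and communication. -/

section Decomposition

variable {Q : Type} [Fintype Q] [DecidableEq Q] {X Y : Type*}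

/-- `F x y` is a sum of `N` products of an operator on the qubits satisfying `p`, depending on `x`
only, and an operator on the qubits satisfying `q`, depending on `y` only. -/
def Decomposes (p q : Q → Prop) [DecidablePred p] [DecidablePred q] (N : ℕ)
    (F : X → Y → Matrix (Q → Bool) (Q → Bool) ℂ) : Prop :=
  ∃ (J : Type) (_ : Fintype J) (A : J → X → Matrix (Q → Bool) (Q → Bool) ℂ)
    (B : J → Y → Matrix (Q → Bool) (Q → Bool) ℂ), Fintype.card J = N ∧
    (∀ j x, A j x ∈ localAlgebra p) ∧ (∀ j y, B j y ∈ localAlgebra q) ∧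
    ∀ x y, F x y = ∑ j, A j x * B j y

theorem Decomposes.flip {p q : Q → Prop} [DecidablePred p] [DecidablePred q] {N : ℕ}
    {F : X → Y → Matrix (Q → Bool) (Q → Bool) ℂ} (hpq : ∀ r, p r → ¬ q r)
    (h : Decomposes p q N F) : Decomposes q p N (fun y x => F x y) := by
  obtain ⟨J, _, A, B, hN, hA, hB, hF⟩ := h
  refine ⟨J, inferInstance, B, A, hN, hB, hA, fun y x => ?_⟩
  refine (hF x y).trans ?_
  exact Finset.sum_congr rfl fun j _ => commute_of_mem_localAlgebra hpq (hA j x) (hB j y)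

theorem Decomposes.conj {p q : Q → Prop} [DecidablePred p] [DecidablePred q] {N : ℕ}
    {F : X → Y → Matrix (Q → Bool) (Q → Bool) ℂ} (hpq : ∀ r, p r → ¬ q r)
    (h : Decomposes p q N F) {U V : X → Matrix (Q → Bool) (Q → Bool) ℂ}
    (hU : ∀ x, U x ∈ localAlgebra p) (hV : ∀ x, V x ∈ localAlgebra p) :
    Decomposes p q N (fun x y => U x * F x y * V x) := by
  obtain ⟨J, _, A, B, hN, hA, hB, hF⟩ := h
  refine ⟨J, inferInstance, fun j x => U x * A j x * V x, B, hN,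
    fun j x => mul_mem (mul_mem (hU x) (hA j x)) (hV x), hB, fun x y => ?_⟩
  simp only [hF, Finset.mul_sum, Finset.sum_mul]
  refine Finset.sum_congr rfl fun j _ => ?_
  simp only [mul_assoc]
  rw [commute_of_mem_localAlgebra hpq (hV x) (hB j y)]

/-- Undoing the transfer of the qubits satisfying `m` multiplies the number of terms by a factor
`4` for each of these qubits. -/
theorem Decomposes.transfer {p q m p' q' : Q → Prop} [DecidablePred p] [DecidablePred q]
    [DecidablePred m] [DecidablePred p'] [DecidablePred q'] {N : ℕ}
    {F : X → Y → Matrix (Q → Bool) (Q → Bool) ℂ} {M : Finset Q} (hM : ∀ r, r ∈ M ↔ m r)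
    (hpq' : ∀ r, p' r → ¬ q' r) (hp : ∀ r, p r ↔ p' r ∧ ¬ m r) (hm : ∀ r, m r → p' r) (hq : ∀ r, q r ↔ m r ∨ q' r)
    (h : Decomposes p q N F) : Decomposes p' q' (N * 4 ^ M.card) F := by
  obtain ⟨J, _, A, B, hN, hA, hB, hF⟩ := h
  have hmq' : ∀ r, m r → ¬ q' r := fun r hr => hpq' r (hm r hr)
  choose C hC hBC using fun j y => exists_sum_single_mul hmq' hq (hB j y)
  -- The receiver's operator is expanded in matrix units on the sent qubits, `2 ^ M.card * 2 ^
  -- M.card` of them, and these are absorbed into the sender's factor.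
  refine ⟨J × (({r // m r} → Bool) × ({r // m r} → Bool)), inferInstance,
    fun j x => A j.1 x * extendById m (Matrix.single j.2.1 j.2.2 1),
    fun j y => C j.1 y j.2, ?_, fun j x => ?_, fun j y => hC _ _ _, fun x y => ?_⟩
  · rw [Fintype.card_prod, hN, Fintype.card_prod, Fintype.card_fun, Fintype.card_bool, ← mul_pow,
      Fintype.card_of_subtype M hM]
    norm_num
  · refine mul_mem_localAlgebra_of_or (fun r hr => ((hp r).1 hr).2)
      (fun r => ?_) (hA _ _) (extendById_mem_localAlgebra _ _)
    rw [hp]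
    by_cases hr : m r <;> simp [hr, hm]
  · rw [hF, Fintype.sum_prod_type]
    refine Finset.sum_congr rfl fun j _ => ?_
    rw [hBC, Finset.mul_sum]
    exact Finset.sum_congr rfl fun i _ => (mul_assoc _ _ _).symm

/-- The projection onto the states in which the qubit `o` is `1`. -/
def projection (o : Q) : Matrix (Q → Bool) (Q → Bool) ℂ :=
  Matrix.diagonal fun s => if s o then 1 else 0

theorem projection_mem_localAlgebra {p : Q → Prop} [DecidablePred p] {o : Q} (ho : p o) :
    projection o ∈ localAlgebra p := by
  have h : projection o =
      extendById p (Matrix.diagonal fun s : {q // p q} → Bool => if s ⟨o, ho⟩ then 1 else 0) := by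
    ext s t
    simp only [projection, extendById, Matrix.diagonal_apply, Matrix.of_apply, ← ite_and]
    congr 1
    refine propext ⟨?_, fun h => ⟨funext fun q => ?_, h.2.2⟩⟩
    · rintro ⟨rfl, hs⟩
      simp [hs]
    · by_cases hq : p q
      · exact congrFun h.2.1 ⟨q, hq⟩
      · exact h.1 q hq
  rw [h]
  exact extendById_mem_localAlgebra _ _

theorem decomposes_projection {p q : Q → Prop} [DecidablePred p] [DecidablePred q] {o : Q}
    (ho : p o ∨ q o) : Decomposes p q 1 (fun (_ : X) (_ : Y) => projection o) := by
  rcases ho with ho | ho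
  · exact ⟨Unit, inferInstance, fun _ _ => projection o, fun _ _ => 1, by simp,
      fun _ _ => projection_mem_localAlgebra ho, fun _ _ => one_mem _, by simp⟩
  · exact ⟨Unit, inferInstance, fun _ _ => 1, fun _ _ => projection o, by simp,
      fun _ _ => one_mem _, fun _ _ => projection_mem_localAlgebra ho, by simp⟩

end Decomposition

/-! ### Normalization of the states. -/

section Norm

theorem conjTranspose_extendById_mul_self {Q : Type} [Fintype Q] [DecidableEq Q]
    (p : Q → Prop) [DecidablePred p] (U : Matrix.unitaryGroup ({q // p q} → Bool) ℂ) :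
    (extendById p U.1)ᴴ * extendById p U.1 = 1 := by
  rw [← extendById_conjTranspose, ← extendById_mul, ← Matrix.star_eq_conjTranspose,
    Unitary.star_mul_self_of_mem U.2, extendById_one]

theorem sum_norm_sq_mulVec {n : Type*} [Fintype n] [DecidableEq n] {U : Matrix n n ℂ}
    (hU : Uᴴ * U = 1) (v : n → ℂ) : ∑ s, ‖(U *ᵥ v) s‖ ^ 2 = ∑ s, ‖v s‖ ^ 2 := by
  have key (w : n → ℂ) : ((∑ s, ‖w s‖ ^ 2 : ℝ) : ℂ) = star w ⬝ᵥ w := by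
    push_cast
    refine Finset.sum_congr rfl fun s _ => ?_
    rw [Pi.star_apply, ← Complex.conj_mul']
    rfl
  have h : star (U *ᵥ v) ⬝ᵥ (U *ᵥ v) = star v ⬝ᵥ v := by
    rw [Matrix.star_mulVec, Matrix.dotProduct_mulVec, Matrix.vecMul_vecMul, hU, Matrix.vecMul_one]
  rw [← key, ← key] at h
  exact_mod_cast h

theorem sum_norm_sq_initialState (k a b : ℕ) : ∑ s, ‖initialState k a b s‖ ^ 2 = 1 := by
  let g (c : Fin k → Bool) : Qubit k a b → Bool :=
    Sum.elim (Sum.elim c fun _ => false) (Sum.elim c fun _ => false)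
  have hg : Function.Injective g := fun c d hcd =>
    funext fun j => congrFun hcd (Sum.inl (Sum.inl j))
  -- The support consists of the `2 ^ k` assignments `g c`, each of weight `2⁻ᵏ`.
  have h1 : ∑ s, ‖initialState k a b s‖ ^ 2 = ∑ c, ‖initialState k a b (g c)‖ ^ 2 := by
    refine (Finset.sum_of_injOn g hg.injOn (by simp) (fun s _ hs => ?_) fun c _ => rfl).symm
    rw [initialState, if_neg]
    · simp
    · rintro ⟨h1, h2, h3⟩
      refine hs ⟨fun j => s (Sum.inl (Sum.inl j)), by simp, ?_⟩
      funext q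
      rcases q with (q | q) | (q | q) <;> simp [g, h1, h2, h3]
  have h2 (c : Fin k → Bool) : ‖initialState k a b (g c)‖ ^ 2 = (1 / 2 : ℝ) ^ k := by
    rw [initialState, if_pos (by simp [g]), norm_pow, Complex.norm_real, ← pow_mul, mul_comm k,
      pow_mul, Real.norm_eq_abs, sq_abs, div_pow, Real.sq_sqrt (by norm_num), one_pow]
  rw [h1]
  simp [h2]

end Norm

/-! ### Exact protocols: eigenvector equation and pulled-back projection. -/

namespace Protocol

variable {X Y : Type*}

theorem roundOperator_of_alice (P : Protocol X Y) {i : ℕ} (hi : sender i = Party.alice)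
    (x : X) (y : Y) : P.roundOperator x y i =
      extendById (fun q => holder P.msg i q = Party.alice) (P.unitaryA i x).1 :=
  if_pos hi

theorem roundOperator_of_bob (P : Protocol X Y) {i : ℕ} (hi : sender i = Party.bob)
    (x : X) (y : Y) : P.roundOperator x y i =
      extendById (fun q => holder P.msg i q = Party.bob) (P.unitaryB i y).1 :=
  if_neg (by simp [hi])

theorem conjTranspose_roundOperator_mul_self (P : Protocol X Y) (x : X) (y : Y) (i : ℕ) :
    (P.roundOperator x y i)ᴴ * P.roundOperator x y i = 1 := by
  cases hi : sender i with
  | alice =>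
    rw [P.roundOperator_of_alice hi]
    exact conjTranspose_extendById_mul_self _ _
  | bob =>
    rw [P.roundOperator_of_bob hi]
    exact conjTranspose_extendById_mul_self _ _

theorem sum_norm_sq_state (P : Protocol X Y) (x : X) (y : Y) (i : ℕ) :
    ∑ s, ‖P.state x y i s‖ ^ 2 = 1 := by
  induction i with
  | zero => exact sum_norm_sq_initialState _ _ _
  | succ i ih =>
    rw [← ih]
    exact sum_norm_sq_mulVec (P.conjTranspose_roundOperator_mul_self x y i) _

/-- The correct outcome already carries the whole norm `1`, so every amplitude on the wrong outcome
vanishes. -/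
theorem projection_mulVec_state {P : Protocol X Y} {f : X → Y → Bool} (hP : P.ComputesExactly f)
    (x : X) (y : Y) :
    projection P.out *ᵥ P.state x y P.rounds =
      (if f x y then 1 else 0 : ℂ) • P.state x y P.rounds := by
  have h1 : ∑ s, (if s P.out = f x y then 0 else ‖P.state x y P.rounds s‖ ^ 2) = 0 := by
    have h2 := P.sum_norm_sq_state x y P.rounds
    have h3 := hP x y
    rw [outputProb] at h3
    refine Eq.trans ?_ (sub_eq_zero.2 (h2.trans h3.symm))
    rw [← Finset.sum_sub_distrib]
    refine Finset.sum_congr rfl fun s _ => ?_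
    split_ifs <;> simp
  have h4 := (Finset.sum_eq_zero_iff_of_nonneg fun s _ => by positivity).1 h1
  funext s
  have h5 := h4 s (Finset.mem_univ s)
  rw [projection, Matrix.mulVec_diagonal, Pi.smul_apply, smul_eq_mul]
  by_cases hs : s P.out = f x y
  · rw [hs]
  · rw [if_neg hs] at h5
    rw [norm_eq_zero.1 (pow_eq_zero_iff two_ne_zero |>.1 h5), mul_zero, mul_zero]

end Protocol

theorem holder_succ_of_mem {k a b : ℕ} {msg : ℕ → Finset (Qubit k a b)} {i : ℕ}
    {q : Qubit k a b} (hq : q ∈ msg i) : holder msg (i + 1) q = sender (i + 1) :=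
  if_pos hq

theorem holder_succ_of_notMem {k a b : ℕ} {msg : ℕ → Finset (Qubit k a b)} {i : ℕ}
    {q : Qubit k a b} (hq : q ∉ msg i) : holder msg (i + 1) q = holder msg i q :=
  if_neg hq

theorem sender_succ_of_alice {i : ℕ} (hi : sender i = Party.alice) :
    sender (i + 1) = Party.bob := by
  unfold sender at *
  grind

theorem sender_succ_of_bob {i : ℕ} (hi : sender i = Party.bob) :
    sender (i + 1) = Party.alice := by
  unfold sender at *
  grind

namespace Protocol

variable {X Y : Type*}

/-- In the Heisenberg picture, the measured projection at the beginning of round `i` has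
`4 ^ c` terms, where `c` is the number of qubits sent from that round on. -/
theorem exists_decomposes {P : Protocol X Y} {f : X → Y → Bool} (hP : P.ComputesExactly f)
    (d i : ℕ) (hi : i + d = P.rounds) :
    ∃ F : X → Y → Matrix (Qubit P.epr P.workA P.workB → Bool)
        (Qubit P.epr P.workA P.workB → Bool) ℂ,
      Decomposes (fun q => holder P.msg i q = Party.alice)
        (fun q => holder P.msg i q = Party.bob)
        (4 ^ ∑ j ∈ Finset.range d, (P.msg (i + j)).card) F ∧
      ∀ x y, F x y *ᵥ P.state x y i = (if f x y then 1 else 0 : ℂ) • P.state x y i := by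
  induction d generalizing i with
  | zero =>
    obtain rfl : i = P.rounds := hi
    refine ⟨fun _ _ => projection P.out, ?_, projection_mulVec_state hP⟩
    simp only [Finset.range_zero, Finset.sum_empty, pow_zero]
    exact decomposes_projection (by cases holder P.msg P.rounds P.out <;> simp)
  | succ d ih =>
    obtain ⟨F, hF, hFs⟩ := ih (i + 1) (by omega)
    refine ⟨fun x y => (P.roundOperator x y i)ᴴ * F x y * P.roundOperator x y i, ?_, ?_⟩
    · have hsum : ∑ j ∈ Finset.range (d + 1), (P.msg (i + j)).card =
          ∑ j ∈ Finset.range d, (P.msg (i + 1 + j)).card + (P.msg i).card := by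
        rw [Finset.sum_range_succ', add_zero]
        simp only [add_assoc, add_comm 1]
      rw [hsum, pow_add]
      have hheld := P.msg_held i (by omega)
      have hab (j : ℕ) : ∀ q, holder P.msg j q = Party.alice → ¬ holder P.msg j q = Party.bob := by
        simp +contextual
      have hba (j : ℕ) : ∀ q, holder P.msg j q = Party.bob → ¬ holder P.msg j q = Party.alice := by
        simp +contextual
      cases hs : sender i with
      | alice =>
        have hs' := sender_succ_of_alice hs
        rw [hs] at hheld
        simp only [P.roundOperator_of_alice hs]
        refine Decomposes.conj (hab i) (hF.transfer (m := (· ∈ P.msg i)) (fun _ => Iff.rfl) (hab i) (fun q => ?_) hheld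
          (fun q => ?_)) (U := fun x => (extendById _ (P.unitaryA i x).1)ᴴ)
          (V := fun x => extendById _ (P.unitaryA i x).1) (fun x => ?_)
          fun x => extendById_mem_localAlgebra _ _
        · by_cases hq : q ∈ P.msg i
          · simp [holder_succ_of_mem hq, hs', hq]
          · simp [holder_succ_of_notMem hq, hq]
        · by_cases hq : q ∈ P.msg i
          · simp [holder_succ_of_mem hq, hs', hq]
          · simp [holder_succ_of_notMem hq, hq]
        · rw [← extendById_conjTranspose]
          exact extendById_mem_localAlgebra _ _
      | bob =>
        have hs' := sender_succ_of_bob hs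
        rw [hs] at hheld
        simp only [P.roundOperator_of_bob hs]
        -- Bob's round is Alice's with the roles exchanged, hence a flip before and after.
        refine (Decomposes.conj (hba i) ((hF.flip (hab _)).transfer (m := (· ∈ P.msg i))
          (fun _ => Iff.rfl) (hba i) (fun q => ?_) hheld (fun q => ?_)) (U := fun y => (extendById _ (P.unitaryB i y).1)ᴴ)
          (V := fun y => extendById _ (P.unitaryB i y).1) (fun x => ?_)
          fun x => extendById_mem_localAlgebra _ _).flip (hba i)
        · by_cases hq : q ∈ P.msg i
          · simp [holder_succ_of_mem hq, hs', hq]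
          · simp [holder_succ_of_notMem hq, hq]
        · by_cases hq : q ∈ P.msg i
          · simp [holder_succ_of_mem hq, hs', hq]
          · simp [holder_succ_of_notMem hq, hq]
        · rw [← extendById_conjTranspose]
          exact extendById_mem_localAlgebra _ _
    · intro x y
      have h1 : P.roundOperator x y i *ᵥ P.state x y i = P.state x y (i + 1) := rfl
      rw [← Matrix.mulVec_mulVec, ← Matrix.mulVec_mulVec, h1, hFs, Matrix.mulVec_smul, ← h1,
        Matrix.mulVec_mulVec, P.conjTranspose_roundOperator_mul_self, Matrix.one_mulVec]

theorem rank_commMatrix_le [Fintype X] [Fintype Y] {P : Protocol X Y} {f : X → Y → Bool}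
    (hP : P.ComputesExactly f) : (commMatrix f).rank ≤ 4 ^ P.cost := by
  obtain ⟨F, ⟨J, _, A, B, hJ, hA, hB, hF⟩, hFs⟩ :=
    exists_decomposes hP P.rounds 0 (zero_add _)
  simp only [zero_add] at hJ
  rw [cost, ← hJ]
  refine rank_le_card_of_mulVec_eq_smul (ψ := initialState P.epr P.workA P.workB) ?_
    (fun A hA B hB => commute_of_mem_localAlgebra (by simp +contextual) hA hB) hA hB _
    fun x y => ?_
  · intro h0
    have h1 := sum_norm_sq_initialState P.epr P.workA P.workB
    simp [h0] at h1
  · rw [← hF]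
    refine (hFs x y).trans ?_
    rw [commMatrix, Matrix.of_apply, apply_ite Complex.ofReal, Complex.ofReal_one,
      Complex.ofReal_zero]
    rfl

end Protocol

theorem logb_le_of_le_four_pow {r c : ℕ} (h : r ≤ 4 ^ c) : Real.logb 2 r / 2 ≤ c := by
  -- Rank `0` is covered by the convention `Real.logb 2 0 = 0`.
  rcases Nat.eq_zero_or_pos r with rfl | hr
  · simp
  have h1 : Real.logb 2 r ≤ Real.logb 2 (2 ^ (2 * c) : ℝ) := by
    refine Real.logb_le_logb_of_le one_lt_two (by exact_mod_cast hr) ?_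
    rw [pow_mul]
    norm_num
    exact_mod_cast h
  rw [Real.logb_pow, Real.logb_self_eq_one one_lt_two] at h1
  push_cast at h1
  linarith

end QComm

theorem mainTheorem1 {X Y : Type*} [Fintype X] [Fintype Y] (f : X → Y → Bool) :
    ((Real.logb 2 ((QComm.commMatrix f).rank : ℝ) / 2 : ℝ) : EReal) ≤
      ((QComm.Qstar f : ENNReal) : EReal) := by
  -- Costs are integers, so the bound may be rounded up and compared with the infimum inside `ℕ∞`.
  have h : ((⌈Real.logb 2 ((QComm.commMatrix f).rank : ℝ) / 2⌉₊ : ℕ) : ℕ∞) ≤ QComm.Qstar f :=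
    le_iInf₂ fun P hP => Nat.cast_le.2 <| Nat.ceil_le.2 <|
      QComm.logb_le_of_le_four_pow (QComm.Protocol.rank_commMatrix_le hP)
  have h1 := EReal.coe_ennreal_le_coe_ennreal_iff.2 (ENat.toENNReal_le.2 h)
  refine le_trans ?_ h1
  rw [ENat.toENNReal_coe]
  exact EReal.coe_le_coe_iff.2 (Nat.le_ceil _)
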